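/- Let $K$ be a compact Hausdorff space and $\psi\colon K\to K$ a continuous map, and suppose that $(K;\psi)$ is totally minimal: $K\neq\emptyset$ and, for every $m\ge 1$, the only closed sets $A\subseteq K$ with $\psi^m(A)\subseteq A$ are $\emptyset$ and $K$. Let $Tf=f\circ\psi$ be the Koopman operator on $C(K)$ (complex-valued continuous functions), let $C(K;\mathbb T)=\{f\in C(K): |f|=1\}$, and let $\Lambda\colon C(K;\mathbb T)\to C(K;\mathbb T)$ be the homomorphism $\Lambda f=Tf\cdot\overline f$. Let $G=\bigcup_{n\ge 0}\ker(\Lambda^n)$ be the group of quasi-eigenvectors and suppose that $(K;\psi)$ has quasi-discrete spectrum, i.e., the linear span of $G$ is dense in $C(K)$ for the uniform norm. Let $(H,\Lambda,\iota)$ be the signature of $(K;\psi)$: $H=\Lambda(G)$ is the group of quasi-eigenvalues, $\Lambda\colon H\to H$ is the restriction of $\Lambda$, and $\iota\colon H_1\to\mathbb T$, where $H_1=\ker(\Lambda|_H)$, is the injective homomorphism that sends each element of $H_1$ (a constant function, since $\psi$ is minimal) to its value. Regard $H$ as a discrete group, with compact dual group $H^*=\mathrm{Hom}(H,\mathbb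 T)$. The map $\Phi(h)=h\cdot\Lambda h$ is an automorphism of $H$; let $\Phi^*\chi=\chi\circ\Phi$ be the dual automorphism of $H^*$, and for $\eta\in H^*$ let $(H^*;\Phi^*,\eta)$ be the system on $H^*$ given by the affine automorphism $\chi\mapsto\Phi^*(\chi)\cdot\eta$. Then $\iota$ has an extension to a homomorphism $H\to\mathbb T$, and for every homomorphism $\eta\colon H\to\mathbb T$ that extends $\iota$, the system $(K;\psi)$ is topologically conjugate to $(H^*;\Phi^*,\eta)$: there is a homeomorphism $\theta\colon K\to H^*$ with $\theta(\psi(x))=\Phi^*(\theta(x))\cdot\eta$ for all $x\in K$. -/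

import Mathlib

noncomputable section

namespace QDS

universe u v

/-! ## Abelian groups with a quasi-nilpotent endomorphism; signatures -/

section Algebra

variable {G : Type u} [CommGroup G]

/-- The subgroup `G_n = ker (Λ ^ n)` of an Abelian group `G` with an endomorphism `Λ`. -/
def iterKer (Λ : G →* G) (n : ℕ) : Subgroup G where
  carrier := {g | (⇑Λ)^[n] g = 1}
  one_mem' := iterate_map_one Λ n
  mul_mem' := by
    intro a b ha hb
    simp only [Set.mem_ofPred_eq] at ha hb ⊢
    rw [iterate_map_mul, ha, hb, one_mul]
  inv_mem' := by
    intro a ha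
    simp only [Set.mem_ofPred_eq] at ha ⊢
    rw [iterate_map_inv, ha, inv_one]

theorem mem_iterKer {Λ : G →* G} {n : ℕ} {g : G} : g ∈ iterKer Λ n ↔ (⇑Λ)^[n] g = 1 :=
  Iff.rfl

theorem iterKer_le_succ (Λ : G →* G) (n : ℕ) : iterKer Λ n ≤ iterKer Λ (n + 1) := by
  intro g hg
  rw [mem_iterKer] at hg ⊢
  rw [Function.iterate_succ_apply', hg, map_one]

theorem iterKer_mono (Λ : G →* G) : Monotone (iterKer Λ) :=
  monotone_nat_of_le_succ (iterKer_le_succ Λ)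

/-- The union `⋃ₙ G_n` of the increasing chain of subgroups `G_n = ker (Λ ^ n)`. -/
def iterKerUnion (Λ : G →* G) : Subgroup G where
  carrier := {g | ∃ n : ℕ, g ∈ iterKer Λ n}
  one_mem' := ⟨0, one_mem _⟩
  mul_mem' := by
    rintro a b ⟨n, hn⟩ ⟨m, hm⟩
    exact ⟨max n m, mul_mem (iterKer_mono Λ (le_max_left n m) hn)
      (iterKer_mono Λ (le_max_right n m) hm)⟩
  inv_mem' := by
    rintro a ⟨n, hn⟩
    exact ⟨n, inv_mem hn⟩

theorem mem_iterKerUnion {Λ : G →* G} {g : G} :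
    g ∈ iterKerUnion Λ ↔ ∃ n : ℕ, (⇑Λ)^[n] g = 1 :=
  Iff.rfl

theorem map_mem_iterKerUnion {Λ : G →* G} {g : G} (hg : g ∈ iterKerUnion Λ) :
    Λ g ∈ iterKerUnion Λ := by
  obtain ⟨n, hn⟩ := hg
  exact ⟨n, by
    have h := iterKer_le_succ Λ n hn
    rwa [mem_iterKer, Function.iterate_succ_apply] at h⟩

/-- `Λ` is quasi-nilpotent if `G = ⋃ₙ ker (Λ ^ n)`. -/
def IsQuasiNilpotent (Λ : G →* G) : Prop :=
  ∀ g : G, ∃ n : ℕ, (⇑Λ)^[n] g = 1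

/-- The homomorphism `Φ g = g * Λ g`. -/
def phiHom (Λ : G →* G) : G →* G :=
  MonoidHom.id G * Λ

@[simp]
theorem phiHom_apply (Λ : G →* G) (g : G) : phiHom Λ g = g * Λ g :=
  rfl

theorem phiHom_bijective {Λ : G →* G} (hΛ : IsQuasiNilpotent Λ) :
    Function.Bijective (phiHom Λ) := by
  constructor
  · rw [injective_iff_map_eq_one]
    intro g hg
    rw [phiHom_apply] at hg
    have h1 : Λ g = g⁻¹ := eq_inv_of_mul_eq_one_right hg
    have key : ∀ n : ℕ, (⇑Λ)^[n] g = 1 → g = 1 := by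
      intro n
      induction n with
      | zero => exact fun h => h
      | succ k ih =>
        intro h
        rw [Function.iterate_succ_apply, h1, iterate_map_inv, inv_eq_one] at h
        exact ih h
    obtain ⟨n, hn⟩ := hΛ g
    exact key n hn
  · have key : ∀ (n : ℕ) (g : G), (⇑Λ)^[n] g = 1 → ∃ h, phiHom Λ h = g := by
      intro n
      induction n with
      | zero => exact fun g hg => ⟨1, by rw [map_one]; exact hg.symm⟩
      | succ k ih =>
        intro g hg
        rw [Function.iterate_succ_apply] at hg
        obtain ⟨h, hh⟩ := ih (Λ g) hg
        refine ⟨g * h⁻¹, ?_⟩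
        rw [map_mul, map_inv, hh, phiHom_apply, mul_inv_cancel_right]
    intro g
    obtain ⟨n, hn⟩ := hΛ g
    exact key n g hn

end Algebra

/-- A signature `(G, Λ, ι)`: an Abelian group `G`, a quasi-nilpotent homomorphism `Λ : G → G`, and
an injective homomorphism `ι` from `G_1 = ker Λ` to the circle group. The group carries no
topology. -/
structure Signature where
  carrier : Type u
  [commGroup : CommGroup carrier]
  Λ : carrier →* carrier
  quasiNilpotent : IsQuasiNilpotent Λ
  ι : Λ.ker →* Circle
  ι_injective : Function.Injective ι

attribute [instance] Signature.commGroup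

namespace Signature

/-- The group of a signature is regarded as a discrete group. -/
instance (S : Signature.{u}) : TopologicalSpace S.carrier := ⊥

instance (S : Signature.{u}) : DiscreteTopology S.carrier := ⟨rfl⟩

/-- The dual group `H^*` of the discrete group `H` of a signature: all homomorphisms from `H` to the
circle, with the topology of pointwise convergence (which is the compact-open topology, as `H` is
discrete); a compact Abelian group. -/
abbrev Dual (S : Signature.{u}) : Type u :=
  PontryaginDual S.carrier

/-- A homomorphism `H → 𝕋` as an element of the dual group. -/
def toDual (S : Signature.{u}) (η : S.carrier →* Circle) : S.Dual :=
  (⟨η, continuous_of_discreteTopology⟩ : S.carrier →ₜ* Circle)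

@[simp]
theorem toDual_apply (S : Signature.{u}) (η : S.carrier →* Circle) (h : S.carrier) :
    S.toDual η h = η h :=
  rfl

/-- The automorphism `Φ h = h * Λ h` of `H`. -/
def Phi (S : Signature.{u}) : S.carrier ≃* S.carrier :=
  MulEquiv.ofBijective (phiHom S.Λ) (phiHom_bijective S.quasiNilpotent)

@[simp]
theorem Phi_apply (S : Signature.{u}) (h : S.carrier) : S.Phi h = h * S.Λ h :=
  rfl

/-- The dual automorphism `Φ^* χ = χ ∘ Φ` of the topological group `H^*`. -/
def PhiDual (S : Signature.{u}) : S.Dual ≃ₜ* S.Dual where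
  toFun := PontryaginDual.map ⟨S.Phi.toMonoidHom, continuous_of_discreteTopology⟩
  invFun := PontryaginDual.map ⟨S.Phi.symm.toMonoidHom, continuous_of_discreteTopology⟩
  left_inv χ := PontryaginDual.ext fun h => congrArg χ (S.Phi.apply_symm_apply h)
  right_inv χ := PontryaginDual.ext fun h => congrArg χ (S.Phi.symm_apply_apply h)
  map_mul' χ₁ χ₂ := map_mul _ χ₁ χ₂
  continuous_toFun := map_continuous _
  continuous_invFun := map_continuous _

@[simp]
theorem PhiDual_apply (S : Signature.{u}) (χ : S.Dual) (h : S.carrier) :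
    S.PhiDual χ h = χ (S.Phi h) :=
  rfl

/-- `η : H → 𝕋` extends `ι : H_1 → 𝕋`. -/
def Extends (S : Signature.{u}) (η : S.carrier →* Circle) : Prop :=
  ∀ h : S.Λ.ker, η (h : S.carrier) = S.ι h

end Signature

/-! ## Topological dynamical systems

A topological dynamical system is a compact Hausdorff space `K` together with a continuous map
`ψ : K → K`. -/

/-- The affine automorphism `γ ↦ Ψ γ * η` of a topological group `Γ`. -/
def affineAut {Γ : Type u} [CommGroup Γ] [TopologicalSpace Γ] [IsTopologicalGroup Γ]
    (Ψ : Γ ≃ₜ* Γ) (η : Γ) : C(Γ, Γ) :=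
  ⟨fun γ => Ψ γ * η, (map_continuous Ψ).mul continuous_const⟩

section Systems

variable {K : Type u} [TopologicalSpace K]

/-- Topological conjugacy (isomorphism) of the systems `(K; ψ)` and `(L; φ)`. -/
def Conjugate {L : Type v} [TopologicalSpace L] (ψ : C(K, K)) (φ : C(L, L)) : Prop :=
  ∃ θ : K ≃ₜ L, ∀ x : K, θ (ψ x) = φ (θ x)

/-- A system is minimal if it is non-empty and the only closed subsets `A` with `f(A) ⊆ A` are the
empty set and the whole space. -/
def IsMinimal (f : K → K) : Prop :=
  Nonempty K ∧ ∀ A : Set K, IsClosed A → Set.MapsTo f A A → A = ∅ ∨ A = Set.univ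

/-- `(K; ψ)` is totally minimal if `(K; ψ ^ m)` is minimal for every `m ≥ 1`. -/
def IsTotallyMinimal (ψ : C(K, K)) : Prop :=
  ∀ m : ℕ, 1 ≤ m → IsMinimal (⇑ψ)^[m]

/-- The Koopman operator `T f = f ∘ ψ` on `C(K)`. -/
def koopman (ψ : C(K, K)) : C(K, ℂ) →ₗ[ℂ] C(K, ℂ) where
  toFun f := f.comp ψ
  map_add' _ _ := rfl
  map_smul' _ _ := rfl

/-- The fixed space `fix(T)` of the Koopman operator. -/
def fixedSpace (ψ : C(K, K)) : Submodule ℂ C(K, ℂ) :=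
  LinearMap.eqLocus (koopman ψ) LinearMap.id

/-- `fix(T)` is one-dimensional: `K` is non-empty and `fix(T) = ℂ1`. -/
def FixedSpaceTrivial (ψ : C(K, K)) : Prop :=
  Nonempty K ∧ fixedSpace ψ = Submodule.span ℂ {(1 : C(K, ℂ))}

theorem IsTotallyMinimal.fixedSpaceTrivial {ψ : C(K, K)} (h : IsTotallyMinimal ψ) :
    FixedSpaceTrivial ψ := by
  obtain ⟨⟨x₀⟩, hmin⟩ := h 1 le_rfl
  refine ⟨⟨x₀⟩, le_antisymm ?_ ?_⟩
  · intro f hf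
    have hf' : ∀ x, f (ψ x) = f x := fun x => DFunLike.congr_fun (show f.comp ψ = f from hf) x
    have hA := hmin {x | f x = f x₀} (isClosed_eq f.continuous continuous_const)
      (by intro x hx
          simp only [Set.mem_ofPred_eq, Function.iterate_one] at hx ⊢
          rw [hf', hx])
    have hA' : {x | f x = f x₀} = Set.univ := by
      rcases hA with h0 | h0
      · exact absurd (show x₀ ∈ {x | f x = f x₀} from rfl) (by rw [h0]; simp)
      · exact h0
    rw [Submodule.mem_span_singleton]
    refine ⟨f x₀, ContinuousMap.ext fun x => ?_⟩
    have hx : f x = f x₀ := by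
      have : x ∈ {x | f x = f x₀} := by rw [hA']; trivial
      exact this
    simp [hx]
  · rw [Submodule.span_singleton_le_iff_mem]
    exact ContinuousMap.ext fun _ => rfl

/-- The inclusion of `C(K; 𝕋) = {f ∈ C(K) : |f| = 1}` into `C(K)`. -/
def toComplex (f : C(K, Circle)) : C(K, ℂ) :=
  ⟨fun x => (f x : ℂ), continuous_subtype_val.comp f.continuous⟩

/-- The derived homomorphism `Λ f = T f * conj f` on `C(K; 𝕋)`; for unimodular `f`, one has
`conj f = f⁻¹`. -/
def derivedHom (ψ : C(K, K)) : C(K, Circle) →* C(K, Circle) where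
  toFun f := f.comp ψ * f⁻¹
  map_one' := by ext x; simp
  map_mul' f g := by
    ext x
    simp only [ContinuousMap.mul_apply, ContinuousMap.comp_apply, ContinuousMap.inv_apply, mul_inv]
    rw [mul_mul_mul_comm]

theorem derivedHom_apply (ψ : C(K, K)) (f : C(K, Circle)) (x : K) :
    derivedHom ψ f x = f (ψ x) * (f x)⁻¹ :=
  rfl

/-- The group `G = ⋃ₙ ker (Λ ^ n)` of all (unimodular) quasi-eigenvectors. -/
def quasiEigenvectors (ψ : C(K, K)) : Subgroup C(K, Circle) :=
  iterKerUnion (derivedHom ψ)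

/-- The group `H = Λ(G)` of all quasi-eigenvalues. -/
def quasiEigenvalues (ψ : C(K, K)) : Subgroup C(K, Circle) :=
  (quasiEigenvectors ψ).map (derivedHom ψ)

/-- `(K; ψ)` has quasi-discrete spectrum if the linear hull of all quasi-eigenvectors is dense in
`C(K)` (with respect to uniform convergence). -/
def HasQuasiDiscreteSpectrum (ψ : C(K, K)) : Prop :=
  Dense (Submodule.span ℂ (toComplex '' (quasiEigenvectors ψ : Set C(K, Circle))) : Set C(K, ℂ))

theorem quasiEigenvalues_le (ψ : C(K, K)) : quasiEigenvalues ψ ≤ quasiEigenvectors ψ := by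
  rintro _ ⟨g, hg, rfl⟩
  exact map_mem_iterKerUnion hg

/-- The restriction of `Λ` to `H`. -/
def derivedHomRestrict (ψ : C(K, K)) : quasiEigenvalues ψ →* quasiEigenvalues ψ where
  toFun h := ⟨derivedHom ψ (h : C(K, Circle)), h, quasiEigenvalues_le ψ h.2, rfl⟩
  map_one' := Subtype.ext (derivedHom ψ).map_one
  map_mul' a b := Subtype.ext ((derivedHom ψ).map_mul a b)

theorem derivedHomRestrict_coe (ψ : C(K, K)) (h : quasiEigenvalues ψ) :
    (derivedHomRestrict ψ h : C(K, Circle)) = derivedHom ψ h :=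
  rfl

theorem derivedHomRestrict_quasiNilpotent (ψ : C(K, K)) :
    IsQuasiNilpotent (derivedHomRestrict ψ) := by
  intro h
  obtain ⟨n, hn⟩ := quasiEigenvalues_le ψ h.2
  refine ⟨n, Subtype.ext ?_⟩
  have key : ∀ (n : ℕ) (h : quasiEigenvalues ψ),
      (((⇑(derivedHomRestrict ψ))^[n] h : quasiEigenvalues ψ) : C(K, Circle))
        = (⇑(derivedHom ψ))^[n] h := by
    intro n
    induction n with
    | zero => exact fun _ => rfl
    | succ k ih =>
      intro h
      rw [Function.iterate_succ_apply, Function.iterate_succ_apply, ih, derivedHomRestrict_coe]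
  rw [key]
  exact hn

/-- If `fix(T) = ℂ1`, an element of `ker Λ` is a constant function. -/
theorem eq_of_derivedHom_eq_one {ψ : C(K, K)} (hfix : FixedSpaceTrivial ψ) {f : C(K, Circle)}
    (hf : derivedHom ψ f = 1) (x y : K) : f x = f y := by
  have hmem : toComplex f ∈ fixedSpace ψ := by
    refine ContinuousMap.ext fun z => ?_
    have hz := DFunLike.congr_fun hf z
    rw [derivedHom_apply] at hz
    exact congrArg (fun c : Circle => (c : ℂ)) (mul_inv_eq_one.mp hz)
  rw [hfix.2, Submodule.mem_span_singleton] at hmem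
  obtain ⟨c, hc⟩ := hmem
  have hval : ∀ z, ((f z : Circle) : ℂ) = c := by
    intro z
    have hz := DFunLike.congr_fun hc z
    simpa [toComplex] using hz.symm
  exact Circle.ext ((hval x).trans (hval y).symm)

/-- The map `ι` that sends a constant function in `ker Λ ∩ H` to its value. -/
def constValue (ψ : C(K, K)) (hfix : FixedSpaceTrivial ψ) :
    (derivedHomRestrict ψ).ker →* Circle where
  toFun h := ((h : quasiEigenvalues ψ) : C(K, Circle)) hfix.1.some
  map_one' := rfl
  map_mul' _ _ := rfl

theorem constValue_eq {ψ : C(K, K)} (hfix : FixedSpaceTrivial ψ)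
    (h : (derivedHomRestrict ψ).ker) (x : K) :
    ((h : quasiEigenvalues ψ) : C(K, Circle)) x = constValue ψ hfix h := by
  refine eq_of_derivedHom_eq_one hfix ?_ x _
  have hh := h.2
  rw [MonoidHom.mem_ker] at hh
  exact congrArg Subtype.val hh

/-- The signature `(H, Λ, ι)` of quasi-eigenvalues of a system `(K; ψ)` whose Koopman operator has
a one-dimensional fixed space. -/
def sig (ψ : C(K, K)) (hfix : FixedSpaceTrivial ψ) : Signature.{u} where
  carrier := quasiEigenvalues ψ
  Λ := derivedHomRestrict ψ
  quasiNilpotent := derivedHomRestrict_quasiNilpotent ψ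
  ι := constValue ψ hfix
  ι_injective := by
    intro a b hab
    refine Subtype.ext (Subtype.ext (ContinuousMap.ext fun x => ?_))
    rw [constValue_eq hfix a x, constValue_eq hfix b x, hab]

end Systems

end QDS

end

/-!
The conjugacy is `θ x = (h ↦ s h x)`, where `s : H →* C(K, 𝕋)` is a homomorphism choosing for every
quasi-eigenvalue `h` a quasi-eigenvector `s h` with `Λ (s h) = h`. Then
`s h (ψ x) = s h x * h x`, and `θ` intertwines `ψ` with the affine automorphism given by `η` exactly
when `h = s (Λ h) * η h`.

Such a section comes from divisibility of the circle (`exists_circleHom_comp_eq`): the elements of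
`H` that are constant are those of `ker Λ`, where `η` agrees with `ι`, so `η` and the identity on
constants combine to a homomorphism on `H · 𝕋`, which extends to `p : C(K, 𝕋) →* 𝕋`
(`exists_circleHom_extending`). The map `g ↦ g * (p g)⁻¹` kills constants and hence factors through
`Λ`; the factor is `s` (`exists_quasiEigenvector_section`).

The map `θ` is injective because quasi-eigenvectors separate points, by density of their span. Its
image is dense, hence everything, because the orbit of any point equidistributes: for a nonconstant
quasi-eigenvector `g` the Birkhoff averages of `g` tend to `0` at every point
(`IsTotallyMinimal.tendsto_birkhoffAverage_zero`). This goes by induction on the `n` with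
`Λ^n g = 1`, using van der Corput's difference trick
(`tendsto_birkhoffAverage_zero_of_correlations`): the increments `T^j g / g` are quasi-eigenvectors
of lower order, and total minimality makes them nonconstant unless `g` is an eigenvector, in which
case the averages are computed directly. So the orbit averages of every trigonometric polynomial on
`H^*` tend to its Haar integral, and a bump function vanishing on the image of `θ` would violate this
(`denseRange_of_tendsto_birkhoffAverage`).
-/

noncomputable section

namespace QDS

open Filter Topology ComplexConjugate MeasureTheory

/-! ### Extension of characters -/

/-- The circle is divisible, hence injective among Abelian groups: a character of `M` that is trivial
on `ker f` factors through a character of all of `N`, although `f` need be neither injective nor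
surjective. -/
theorem exists_circleHom_comp_eq {M N : Type*} [CommGroup M] [CommGroup N] (f : M →* N)
    (q : M →* Circle) (h : f.ker ≤ q.ker) : ∃ p : N →* Circle, p.comp f = q := by
  have hroot : ∀ {n : ℤ}, n ≠ 0 →
      Function.Surjective fun a : Additive Circle => n • a := by
    intro n hn a
    obtain ⟨t, ht⟩ := Circle.exp_surjective a.toMul
    refine ⟨Additive.ofMul (Circle.exp (t / n)), ?_⟩
    have hn' : (n : ℝ) ≠ 0 := Int.cast_ne_zero.mpr hn
    change Additive.ofMul (Circle.exp (t / n) ^ n) = Additive.ofMul a.toMul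
    rw [← ht, ← Circle.exp_zsmul, zsmul_eq_mul, mul_div_cancel₀ _ hn']
  let : DivisibleBy (Additive Circle) ℤ := divisibleByOfSMulRightSurj _ _ hroot
  obtain ⟨p, hp⟩ := (Module.Baer.of_divisible (Additive Circle)).extension_property_addMonoidHom
    (MonoidHom.toAdditive (QuotientGroup.kerLift f)) (QuotientGroup.kerLift_injective f)
    (MonoidHom.toAdditive (QuotientGroup.lift f.ker q h))
  refine ⟨MonoidHom.toAdditive.symm p, MonoidHom.ext fun m => ?_⟩
  exact DFunLike.congr_fun hp (Additive.ofMul (m : M ⧸ f.ker))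

/-! ### Birkhoff averages and van der Corput's inequality -/

section Averages

variable {X : Type*}

/-- Replacing a bounded `g` by `g ∘ f^j` does not change the limit behaviour of its averages. -/
theorem tendsto_birkhoffAverage_iterate_sub (f : X → X) {g : X → ℂ} (hg : ∀ y, ‖g y‖ ≤ 1)
    (x : X) (j : ℕ) :
    Tendsto (fun n => birkhoffAverage ℂ f (fun y => g (f^[j] y)) n x - birkhoffAverage ℂ f g n x)
      atTop (𝓝 0) := by
  have hcomm : ∀ n, birkhoffAverage ℂ f (fun y => g (f^[j] y)) n x
      = birkhoffAverage ℂ f g n (f^[j] x) := by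
    intro n
    simp only [birkhoffAverage, birkhoffSum, ← Function.iterate_add_apply, add_comm]
  simp only [hcomm]
  have hb : Bornology.IsBounded (Set.range g) :=
    (Metric.isBounded_closedBall (x := (0 : ℂ)) (r := 1)).subset
      (by rintro _ ⟨y, rfl⟩; simpa using hg y)
  induction j with
  | zero => simp
  | succ j ih =>
    have h := (tendsto_birkhoffAverage_apply_sub_birkhoffAverage' ℂ hb f (f^[j] x)).add
      (ih fun n => by
        simp only [birkhoffAverage, birkhoffSum, ← Function.iterate_add_apply, add_comm])
    simpa [Function.iterate_succ_apply'] using h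

theorem birkhoffAverage_finset_sum {ι : Type*} (s : Finset ι) (f : X → X) (g : ι → X → ℂ) (n : ℕ)
    (x : X) : birkhoffAverage ℂ f (fun y => ∑ i ∈ s, g i y) n x
      = ∑ i ∈ s, birkhoffAverage ℂ f (g i) n x := by
  simp only [birkhoffAverage, birkhoffSum, smul_eq_mul]
  rw [Finset.sum_comm, Finset.mul_sum]

theorem norm_birkhoffAverage_le (f : X → X) {g : X → ℂ} {C : ℝ} (hC : 0 ≤ C)
    (hg : ∀ y, ‖g y‖ ≤ C) (n : ℕ) (x : X) : ‖birkhoffAverage ℂ f g n x‖ ≤ C := by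
  rcases Nat.eq_zero_or_pos n with rfl | hn
  · simpa using hC
  · have hn' : (0 : ℝ) < n := Nat.cast_pos.mpr hn
    have h : ‖birkhoffSum f g n x‖ ≤ n * C := by
      simpa [birkhoffSum] using
        norm_sum_le_of_le (Finset.range n) (fun k _ => hg (f^[k] x))
    rw [birkhoffAverage, norm_smul, norm_inv, Complex.norm_natCast, inv_mul_le_iff₀ hn']
    exact h

/-- Cauchy–Schwarz for the uniform measure on a finite orbit segment; the right-hand average is that
of `‖g‖ ^ 2`. -/
theorem norm_birkhoffAverage_sq_le (f : X → X) (g : X → ℂ) (n : ℕ) (x : X) :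
    ‖birkhoffAverage ℂ f g n x‖ ^ 2 ≤ ‖birkhoffAverage ℂ f (fun y => g y * conj (g y)) n x‖ := by
  rcases Nat.eq_zero_or_pos n with rfl | hn
  · simp
  · have hn' : (0 : ℝ) < n := Nat.cast_pos.mpr hn
    have h1 : ‖birkhoffSum f g n x‖ ^ 2 ≤ n * ∑ k ∈ Finset.range n, ‖g (f^[k] x)‖ ^ 2 := by
      refine (pow_le_pow_left₀ (norm_nonneg _) (norm_sum_le _ _) 2).trans ?_
      simpa using sq_sum_le_card_mul_sum_sq (s := Finset.range n) (f := fun k => ‖g (f^[k] x)‖)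
    have h2 : birkhoffSum f (fun y => g y * conj (g y)) n x
        = ((∑ k ∈ Finset.range n, ‖g (f^[k] x)‖ ^ 2 : ℝ) : ℂ) := by
      simp [birkhoffSum, Complex.mul_conj']
    have h3 : 0 ≤ ∑ k ∈ Finset.range n, ‖g (f^[k] x)‖ ^ 2 := by positivity
    rw [birkhoffAverage, birkhoffAverage, h2, norm_smul, norm_smul, norm_inv, Complex.norm_natCast,
      Complex.norm_of_nonneg h3, mul_pow]
    calc ((n : ℝ)⁻¹) ^ 2 * ‖birkhoffSum f g n x‖ ^ 2
        ≤ ((n : ℝ)⁻¹) ^ 2 * (n * ∑ k ∈ Finset.range n, ‖g (f^[k] x)‖ ^ 2) := by gcongr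
      _ = _ := by field_simp

/-- Van der Corput's difference theorem along an orbit. With `b = ∑ j < M, g ∘ f^j`, the averages of
`b` and of `M * g` agree asymptotically, while those of `‖b‖ ^ 2` are asymptotically at most `M`, since
all off-diagonal correlations vanish; by Cauchy–Schwarz the averages of `g` are asymptotically at
most `1 / √M`. -/
theorem tendsto_birkhoffAverage_zero_of_correlations (f : X → X) {g : X → ℂ}
    (hg : ∀ y, ‖g y‖ ≤ 1) (x : X)
    (hcor : ∀ j, 1 ≤ j →
      Tendsto (fun n => birkhoffAverage ℂ f (fun y => g (f^[j] y) * conj (g y)) n x)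
        atTop (𝓝 0)) :
    Tendsto (fun n => birkhoffAverage ℂ f g n x) atTop (𝓝 0) := by
  have hlt : ∀ i j : ℕ, i < j →
      Tendsto (fun n => birkhoffAverage ℂ f (fun y => g (f^[j] y) * conj (g (f^[i] y))) n x)
        atTop (𝓝 0) := by
    intro i j hij
    have h := (tendsto_birkhoffAverage_iterate_sub f
      (g := fun y => g (f^[j - i] y) * conj (g y)) (fun y => by
        rw [norm_mul, RCLike.norm_conj]
        exact mul_le_one₀ (hg _) (norm_nonneg _) (hg _)) x i).add (hcor (j - i) (by omega))
    simpa [← Function.iterate_add_apply, Nat.sub_add_cancel hij.le] using h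
  have hne : ∀ i j : ℕ, i ≠ j →
      Tendsto (fun n => birkhoffAverage ℂ f (fun y => g (f^[i] y) * conj (g (f^[j] y))) n x)
        atTop (𝓝 0) := by
    intro i j hij
    rcases lt_or_gt_of_ne hij with h | h
    · have h' := (Complex.continuous_conj.tendsto 0).comp (hlt i j h)
      rw [map_zero] at h'
      refine h'.congr fun n => ?_
      simp [birkhoffAverage, birkhoffSum, mul_comm]
    · exact hlt j i h
  rw [Metric.tendsto_atTop]
  intro ε hε
  -- `M` is a square to keep the bound `√(M + 1) ≤ m + 1` rational; `(m + 2) / m ^ 2 ≤ 3 / m < ε`.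
  obtain ⟨m, hm⟩ := exists_nat_gt (3 / ε)
  have hm0 : (0 : ℝ) < m := lt_trans (by positivity) hm
  have hm1 : (1 : ℝ) ≤ m := by exact_mod_cast (Nat.cast_pos.mp hm0)
  set M : ℕ := m ^ 2 with hM
  set b : X → ℂ := fun y => ∑ j ∈ Finset.range M, g (f^[j] y) with hb
  have hb1 : Tendsto (fun n => birkhoffAverage ℂ f b n x - M * birkhoffAverage ℂ f g n x)
      atTop (𝓝 0) := by
    have h := tendsto_finsetSum (Finset.range M)
      (fun j _ => tendsto_birkhoffAverage_iterate_sub f hg x j)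
    simpa [hb, birkhoffAverage_finset_sum] using h
  have hb2 : ∀ᶠ n in atTop,
      ‖birkhoffAverage ℂ f (fun y => b y * conj (b y)) n x‖ ≤ M + 1 := by
    -- Split the double sum into its off-diagonal and diagonal parts.
    have hexp : ∀ n, birkhoffAverage ℂ f (fun y => b y * conj (b y)) n x
        = (∑ i ∈ Finset.range M, ∑ j ∈ Finset.range M, if i = j then 0 else
            birkhoffAverage ℂ f (fun y => g (f^[i] y) * conj (g (f^[j] y))) n x)
          + ∑ i ∈ Finset.range M,
            birkhoffAverage ℂ f (fun y => g (f^[i] y) * conj (g (f^[i] y))) n x := by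
      intro n
      have : (fun y => b y * conj (b y)) = fun y => ∑ i ∈ Finset.range M, ∑ j ∈ Finset.range M,
          g (f^[i] y) * conj (g (f^[j] y)) := by
        funext y
        simp only [hb, map_sum, Finset.sum_mul_sum]
      rw [this, birkhoffAverage_finset_sum, ← Finset.sum_add_distrib]
      refine Finset.sum_congr rfl fun i hi => ?_
      rw [birkhoffAverage_finset_sum, ← Finset.add_sum_erase _ _ hi, ← Finset.add_sum_erase _ _ hi,
        if_pos rfl, zero_add, add_comm]
      congr 1
      exact Finset.sum_congr rfl fun j hj => (if_neg (Finset.ne_of_mem_erase hj).symm).symm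
    have hoff : Tendsto (fun n => ∑ i ∈ Finset.range M, ∑ j ∈ Finset.range M, if i = j then 0 else
        birkhoffAverage ℂ f (fun y => g (f^[i] y) * conj (g (f^[j] y))) n x) atTop (𝓝 0) := by
      have h : Tendsto (fun n => ∑ i ∈ Finset.range M, ∑ j ∈ Finset.range M, if i = j then 0 else
        birkhoffAverage ℂ f (fun y => g (f^[i] y) * conj (g (f^[j] y))) n x) atTop
          (𝓝 (∑ i ∈ Finset.range M, ∑ j ∈ Finset.range M, (0 : ℂ))) := by
        refine tendsto_finsetSum _ fun i _ => tendsto_finsetSum _ fun j _ => ?_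
        by_cases hij : i = j
        · simp [hij]
        · simpa [hij] using hne i j hij
      simpa using h
    have hev := (Metric.tendsto_atTop.mp hoff) 1 one_pos
    obtain ⟨N, hN⟩ := hev
    filter_upwards [eventually_ge_atTop N] with n hn
    have h1 := hN n hn
    rw [dist_zero_right] at h1
    rw [hexp]
    have h2 : ‖∑ i ∈ Finset.range M,
        birkhoffAverage ℂ f (fun y => g (f^[i] y) * conj (g (f^[i] y))) n x‖ ≤ M := by
      have := norm_sum_le_of_le (Finset.range M) (f := fun i =>
        birkhoffAverage ℂ f (fun y => g (f^[i] y) * conj (g (f^[i] y))) n x) (n := fun _ => 1)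
        (fun i _ => norm_birkhoffAverage_le f zero_le_one (fun y => by
          rw [norm_mul, RCLike.norm_conj]
          exact mul_le_one₀ (hg _) (norm_nonneg _) (hg _)) n x)
      simpa using this
    calc _ ≤ _ := norm_add_le _ _
      _ ≤ _ := by linarith
  obtain ⟨N₁, hN₁⟩ := (Metric.tendsto_atTop.mp hb1) 1 one_pos
  obtain ⟨N₂, hN₂⟩ := eventually_atTop.mp hb2
  refine ⟨max N₁ N₂, fun n hn => ?_⟩
  have h1 := hN₁ n (le_trans (le_max_left _ _) hn)
  have h2 := hN₂ n (le_trans (le_max_right _ _) hn)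
  rw [dist_zero_right] at h1 ⊢
  have h3 : ‖birkhoffAverage ℂ f b n x‖ ≤ m + 1 := by
    refine abs_le_of_sq_le_sq' ((norm_birkhoffAverage_sq_le f b n x).trans (h2.trans ?_))
      (by positivity) |>.2
    rw [hM]
    push_cast
    nlinarith
  have h4 : (m : ℝ) ^ 2 * ‖birkhoffAverage ℂ f g n x‖ ≤ m + 2 := by
    have : ‖(M : ℂ) * birkhoffAverage ℂ f g n x‖
        ≤ ‖birkhoffAverage ℂ f b n x‖
          + ‖birkhoffAverage ℂ f b n x - M * birkhoffAverage ℂ f g n x‖ := by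
      simpa using norm_sub_le (birkhoffAverage ℂ f b n x)
        (birkhoffAverage ℂ f b n x - M * birkhoffAverage ℂ f g n x)
    rw [norm_mul, Complex.norm_natCast] at this
    have hMm : (M : ℝ) = (m : ℝ) ^ 2 := by rw [hM, Nat.cast_pow]
    rw [hMm] at this
    linarith
  rw [div_lt_iff₀ hε] at hm
  by_contra hcon
  push Not at hcon
  have h5 : (m : ℝ) ^ 2 * ε ≤ m + 2 := le_trans (by gcongr) h4
  nlinarith
end Averages

/-! ### Equidistribution in the dual of a discrete group -/

section DualGroup

variable {H : Type*} [CommGroup H] [TopologicalSpace H]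

/-- Evaluation at `h`, as a complex-valued continuous function on the dual group; multiplicative
in `h`. -/
def dualEval : H →* C(PontryaginDual H, ℂ) where
  toFun h := ⟨fun χ => (χ h : ℂ), by
    refine continuous_subtype_val.comp ?_
    exact (continuous_eval_const (F := C(H, Circle)) h).comp
      (ContinuousMonoidHom.isInducing_toContinuousMap H Circle).continuous⟩
  map_one' := by ext χ; simp
  map_mul' a b := by ext χ; simp

@[simp]
theorem dualEval_apply (h : H) (χ : PontryaginDual H) : dualEval h χ = (χ h : ℂ) :=
  rfl

/-- By Stone–Weierstrass, trigonometric polynomials are dense in the continuous functions on the dual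
group. -/
theorem dense_span_dualEval [DiscreteTopology H] :
    (Submodule.span ℂ (Set.range (dualEval (H := H)))).topologicalClosure = ⊤ := by
  let A : StarSubalgebra ℂ C(PontryaginDual H, ℂ) :=
    { toSubalgebra := Algebra.adjoin ℂ (Set.range dualEval)
      star_mem' := by
        change Algebra.adjoin ℂ (Set.range (dualEval (H := H))) ≤
          star (Algebra.adjoin ℂ (Set.range dualEval))
        refine Algebra.adjoin_le ?_
        rintro - ⟨h, rfl⟩
        refine Algebra.subset_adjoin ⟨h⁻¹, ContinuousMap.ext fun χ => ?_⟩
        rw [dualEval_apply, map_inv, Circle.coe_inv_eq_conj]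
        rfl }
  have hA : Subalgebra.toSubmodule A.toSubalgebra = Submodule.span ℂ (Set.range dualEval) := by
    change Subalgebra.toSubmodule (Algebra.adjoin ℂ _) = _
    rw [Algebra.adjoin_eq_span, ← MonoidHom.coe_mrange, Submonoid.closure_eq]
  have hsep : A.SeparatesPoints := by
    intro χ₁ χ₂ hne
    by_contra! hcon
    refine hne (PontryaginDual.ext fun h => Circle.ext ?_)
    exact hcon _ ⟨dualEval h, Algebra.subset_adjoin ⟨h, rfl⟩, rfl⟩
  rw [← hA]
  exact congr_arg (Subalgebra.toSubmodule <| StarSubalgebra.toSubalgebra ·)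
    (ContinuousMap.starSubalgebra_topologicalClosure_eq_top_of_separatesPoints A hsep)

/-- Translating by `χ₀` multiplies the integral by `χ₀ h ≠ 1`. -/
theorem integral_dualEval [DiscreteTopology H] [MeasurableSpace (PontryaginDual H)]
    [BorelSpace (PontryaginDual H)] (μ : Measure (PontryaginDual H)) [μ.IsMulLeftInvariant]
    {h : H} {χ₀ : PontryaginDual H} (hχ₀ : χ₀ h ≠ 1) :
    ∫ χ, dualEval h χ ∂μ = 0 := by
  have key : ∫ χ, dualEval h χ ∂μ = (χ₀ h : ℂ) * ∫ χ, dualEval h χ ∂μ := by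
    rw [← integral_const_mul, ← integral_mul_left_eq_self _ χ₀]
    rfl
  have h1 : (χ₀ h : ℂ) - 1 ≠ 0 := sub_ne_zero.mpr fun h => hχ₀ (Circle.ext h)
  refine (mul_eq_zero.mp ?_).resolve_left h1
  rw [sub_mul, ← key, one_mul, sub_self]

/-- If the averages of every nontrivial `h`, regarded as a character of the dual group,
tend to `0` along the `θ`-image of an orbit, then this image equidistributes with respect to Haar
measure, so the range of `θ` is dense. No topology on `X` is involved. -/
theorem denseRange_of_tendsto_birkhoffAverage [DiscreteTopology H] {X : Type*} (f : X → X) (x : X)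
    (θ : X → PontryaginDual H)
    (hθ : ∀ h : H, h ≠ 1 →
      Tendsto (fun n => birkhoffAverage ℂ f (fun y => (θ y h : ℂ)) n x) atTop (𝓝 0)) :
    DenseRange θ := by
  let _ : MeasurableSpace (PontryaginDual H) := borel _
  have _ : BorelSpace (PontryaginDual H) := ⟨rfl⟩
  let μ : Measure (PontryaginDual H) := Measure.haarMeasure ⊤
  have hμ : IsProbabilityMeasure μ := ⟨Measure.haarMeasure_self (K₀ := ⊤)⟩
  have hint : ∀ F : C(PontryaginDual H, ℂ), Integrable F μ := fun F =>
    F.continuous.integrable_of_hasCompactSupport (HasCompactSupport.of_compactSpace _)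
  have hone : Tendsto (fun n => birkhoffAverage ℂ f (fun _ => (1 : ℂ)) n x) atTop (𝓝 1) := by
    refine tendsto_const_nhds.congr' ?_
    filter_upwards [eventually_ne_atTop 0] with n hn
    have hn' : (n : ℂ) ≠ 0 := Nat.cast_ne_zero.mpr hn
    simp [birkhoffAverage, birkhoffSum, hn']
  -- Equidistribution holds for trigonometric polynomials.
  have htrig : ∀ P ∈ Submodule.span ℂ (Set.range (dualEval (H := H))),
      Tendsto (fun n => birkhoffAverage ℂ f (fun y => P (θ y)) n x) atTop (𝓝 (∫ χ, P χ ∂μ)) := by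
    intro P hP
    induction hP using Submodule.span_induction with
    | mem P hP =>
      obtain ⟨h, rfl⟩ := hP
      by_cases hh : h = 1
      · subst hh
        simpa using hone
      · -- The averages would tend to `1` if `h` were trivial on the range of `θ`.
        obtain ⟨y, hy⟩ : ∃ y, θ y h ≠ 1 := by
          by_contra! hall
          refine one_ne_zero (tendsto_nhds_unique (hone.congr fun n => ?_) (hθ h hh))
          simp [hall]
        rw [integral_dualEval μ hy]
        exact hθ h hh
    | zero => simp [birkhoffAverage, birkhoffSum]
    | add P Q _ _ hP hQ =>
      have h := hP.add hQ
      rw [← integral_add (hint P) (hint Q)] at h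
      refine h.congr fun n => ?_
      simp [birkhoffAverage, birkhoffSum, Finset.sum_add_distrib, mul_add]
    | smul c P _ hP =>
      have h := hP.const_mul c
      rw [← integral_const_mul] at h
      refine h.congr fun n => ?_
      simp [birkhoffAverage, birkhoffSum, Finset.mul_sum, mul_left_comm]
  by_contra hcon
  obtain ⟨χ₀, hχ₀⟩ : ∃ χ₀, χ₀ ∉ closure (Set.range θ) := by
    simpa [DenseRange, Dense] using hcon
  obtain ⟨F, hF0, hF1, hF⟩ := exists_continuous_zero_one_of_isClosed
    (isClosed_closure (s := Set.range θ)) (isClosed_singleton (x := χ₀))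
    (Set.disjoint_singleton_right.mpr hχ₀)
  have hpos : 0 < ∫ χ, F χ ∂μ :=
    F.continuous.integral_pos_of_hasCompactSupport_nonneg_nonzero
      (HasCompactSupport.of_compactSpace _) (fun χ => (hF χ).1)
      (x := χ₀) (by rw [hF1 rfl]; exact one_ne_zero)
  let F' : C(PontryaginDual H, ℂ) :=
    ⟨fun χ => (F χ : ℂ), Complex.continuous_ofReal.comp F.continuous⟩
  have hF' : ‖∫ χ, F' χ ∂μ‖ = ∫ χ, F χ ∂μ := by
    change ‖∫ χ, (F χ : ℂ) ∂μ‖ = _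
    rw [integral_complex_ofReal, Complex.norm_of_nonneg hpos.le]
  set c : ℝ := ∫ χ, F χ ∂μ with hc
  have hmem : F' ∈ closure (Submodule.span ℂ (Set.range (dualEval (H := H))) :
      Set C(PontryaginDual H, ℂ)) := by
    rw [← Submodule.topologicalClosure_coe, dense_span_dualEval]
    trivial
  obtain ⟨P, hP, hPF⟩ := Metric.mem_closure_iff.mp hmem (c / 3) (by positivity)
  have hPF' : ∀ χ, ‖F' χ - P χ‖ ≤ c / 3 := fun χ => by
    rw [← dist_eq_norm]
    exact (ContinuousMap.dist_apply_le_dist χ).trans hPF.le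
  have h1 : ‖∫ χ, P χ ∂μ‖ ≤ c / 3 := by
    refine le_of_tendsto (htrig P hP).norm (Eventually.of_forall fun n => ?_)
    refine norm_birkhoffAverage_le f (by positivity) (fun y => ?_) n x
    have h0 : F' (θ y) = 0 := by
      change ((F (θ y) : ℝ) : ℂ) = 0
      rw [hF0 (subset_closure ⟨y, rfl⟩)]
      simp
    simpa [h0] using hPF' (θ y)
  have h2 : ‖∫ χ, F' χ ∂μ - ∫ χ, P χ ∂μ‖ ≤ c / 3 := by
    rw [← integral_sub (hint F') (hint P)]
    simpa using norm_integral_le_of_norm_le_const (μ := μ) (Eventually.of_forall hPF')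
  have h3 := norm_le_norm_add_norm_sub' (∫ χ, F' χ ∂μ) (∫ χ, P χ ∂μ)
  rw [hF'] at h3
  linarith

end DualGroup

/-! ### Quasi-eigenvectors of totally minimal systems -/

section Systems

variable {K : Type*} [TopologicalSpace K]

theorem derivedHom_const (ψ : C(K, K)) (c : Circle) :
    derivedHom ψ (ContinuousMap.const K c) = 1 := by
  ext x
  simp [derivedHom_apply]

theorem derivedHom_eq_one_iff {ψ : C(K, K)} {g : C(K, Circle)} :
    derivedHom ψ g = 1 ↔ ∀ x, g (ψ x) = g x := by
  simp only [DFunLike.ext_iff, derivedHom_apply, ContinuousMap.one_apply, mul_inv_eq_one]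

/-- The iterate `ψ^j` as a continuous map. -/
def iterateMap (ψ : C(K, K)) (j : ℕ) : C(K, K) :=
  ⟨(⇑ψ)^[j], ψ.continuous.iterate j⟩

theorem iterateMap_apply (ψ : C(K, K)) (j : ℕ) (x : K) : iterateMap ψ j x = (⇑ψ)^[j] x :=
  rfl

/-- Both derived homomorphisms have the form `f ↦ T f / f`, for commuting Koopman operators `T`. -/
theorem derivedHom_iterateMap_commute (ψ : C(K, K)) (j : ℕ) :
    Function.Commute (derivedHom (iterateMap ψ j)) (derivedHom ψ) := by
  intro g
  refine ContinuousMap.ext fun x => ?_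
  simp only [derivedHom_apply, iterateMap_apply, ← Function.iterate_succ_apply' (⇑ψ),
    ← Function.iterate_succ_apply (⇑ψ), ← div_eq_mul_inv]
  exact div_div_div_comm _ _ _ _

theorem derivedHom_iterateMap_eq_one {ψ : C(K, K)} {g : C(K, Circle)} (hg : derivedHom ψ g = 1)
    (j : ℕ) : derivedHom (iterateMap ψ j) g = 1 := by
  rw [derivedHom_eq_one_iff] at hg ⊢
  intro x
  rw [iterateMap_apply]
  induction j with
  | zero => rfl
  | succ j ih => rw [Function.iterate_succ_apply', hg, ih]

/-- A `ψ^j`-invariant unimodular function is `ψ`-invariant, by minimality of `ψ^j`. -/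
theorem IsTotallyMinimal.derivedHom_eq_one {ψ : C(K, K)} (hmin : IsTotallyMinimal ψ)
    {j : ℕ} (hj : 1 ≤ j) {g : C(K, Circle)} (hg : derivedHom (iterateMap ψ j) g = 1) :
    derivedHom ψ g = 1 := by
  rw [derivedHom_eq_one_iff] at hg ⊢
  obtain ⟨⟨x₀⟩, h⟩ := hmin j hj
  have huniv : {x | g x = g x₀} = Set.univ :=
    (h _ (isClosed_eq g.continuous continuous_const) fun x hx => (hg x).trans hx).resolve_left
      (Set.Nonempty.ne_empty ⟨x₀, rfl⟩)
  have hconst : ∀ x, g x = g x₀ := fun x => Set.eq_univ_iff_forall.mp huniv x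
  intro x
  rw [hconst, hconst x]

theorem tendsto_birkhoffAverage_eigenvector {X : Type*} {f : X → X} {g : X → Circle} {c : Circle}
    (hc : c ≠ 1) (hg : ∀ y, g (f y) = c * g y) (x : X) :
    Tendsto (fun n => birkhoffAverage ℂ f (fun y => (g y : ℂ)) n x) atTop (𝓝 0) := by
  have hcont := tendsto_birkhoffAverage_iterate_sub f (g := fun y => (g y : ℂ))
    (fun y => (Circle.norm_coe _).le) x 1
  have hc' : (c : ℂ) - 1 ≠ 0 := sub_ne_zero.mpr fun h => hc (Circle.ext h)
  -- For an eigenvector, the average of `g ∘ f - g` is `c - 1` times that of `g`.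
  have h := hcont.const_mul ((c : ℂ) - 1)⁻¹
  rw [mul_zero] at h
  refine h.congr fun n => ?_
  simp only [birkhoffAverage, birkhoffSum, Function.iterate_one, hg, Circle.coe_mul,
    ← Finset.mul_sum, smul_eq_mul]
  field_simp

/-- The averages of a nonconstant quasi-eigenvector tend to `0` at every point. -/
theorem IsTotallyMinimal.tendsto_birkhoffAverage_zero {ψ : C(K, K)} (hmin : IsTotallyMinimal ψ)
    {g : C(K, Circle)} (hg : g ∈ quasiEigenvectors ψ) (hne : derivedHom ψ g ≠ 1) (x : K) :
    Tendsto (fun n => birkhoffAverage ℂ ψ (fun y => (g y : ℂ)) n x) atTop (𝓝 0) := by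
  obtain ⟨n, hn⟩ := hg
  rw [mem_iterKer] at hn
  induction n generalizing g with
  | zero => exact absurd ((congrArg _ hn).trans (map_one _)) hne
  | succ n ih =>
    by_cases h2 : derivedHom ψ (derivedHom ψ g) = 1
    · -- `g` is an eigenvector whose eigenvalue is the constant value of `Λ g`.
      have hconst := eq_of_derivedHom_eq_one hmin.fixedSpaceTrivial h2
      refine tendsto_birkhoffAverage_eigenvector (c := derivedHom ψ g x) (fun hc => hne ?_)
        (fun y => ?_) x
      · exact ContinuousMap.ext fun y => (hconst y x).trans hc
      · rw [hconst x y, derivedHom_apply, inv_mul_cancel_right]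
    · -- The correlation at lag `j` is the average of `T^j g / g`, of order `n`. If it were constant,
      -- then `T^j` would fix `Λ g`, so `Λ g` would be constant.
      refine tendsto_birkhoffAverage_zero_of_correlations ψ (fun y => (Circle.norm_coe _).le) x
        fun j hj => ?_
      have h := ih (g := derivedHom (iterateMap ψ j) g) (fun h => h2 ?_) ?_
      · refine h.congr fun n => ?_
        simp only [derivedHom_apply, iterateMap_apply, Circle.coe_mul, Circle.coe_inv_eq_conj]
      · refine hmin.derivedHom_eq_one hj ?_
        rw [derivedHom_iterateMap_commute ψ j g, h]
      · rw [← (derivedHom_iterateMap_commute ψ j).iterate_right n g]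
        refine derivedHom_iterateMap_eq_one ?_ j
        rwa [← Function.iterate_succ_apply' (⇑(derivedHom ψ))]

/-- Quasi-eigenvectors separate the points of `K`. -/
theorem HasQuasiDiscreteSpectrum.eq_of_forall [CompactSpace K] [T2Space K] {ψ : C(K, K)}
    (hqds : HasQuasiDiscreteSpectrum ψ) {x y : K}
    (h : ∀ g ∈ quasiEigenvectors ψ, g x = g y) : x = y := by
  have hclosed : IsClosed {f : C(K, ℂ) | f x = f y} :=
    isClosed_eq (continuous_eval_const x) (continuous_eval_const y)
  have hspan : (Submodule.span ℂ (toComplex '' (quasiEigenvectors ψ : Set C(K, Circle))) :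
      Set C(K, ℂ)) ⊆ {f : C(K, ℂ) | f x = f y} := by
    intro f hf
    induction hf using Submodule.span_induction with
    | mem f hf =>
      obtain ⟨g, hg, rfl⟩ := hf
      exact congrArg (fun c : Circle => (c : ℂ)) (h g hg)
    | zero => rfl
    | add f₁ f₂ _ _ h₁ h₂ => exact congrArg₂ (· + ·) h₁ h₂
    | smul c f _ hf => exact congrArg (c • ·) hf
  by_contra hxy
  obtain ⟨F, hF0, hF1, -⟩ := exists_continuous_zero_one_of_isClosed
    (isClosed_singleton (x := x)) (isClosed_singleton (x := y)) (Set.disjoint_singleton.mpr hxy)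
  have hmem : (⟨fun z => (F z : ℂ), Complex.continuous_ofReal.comp F.continuous⟩ : C(K, ℂ))
      ∈ {f : C(K, ℂ) | f x = f y} := closure_minimal hspan hclosed (hqds _)
  have hF : (F x : ℂ) = F y := hmem
  rw [hF0 rfl, hF1 rfl] at hF
  simp at hF

/-! ### Extension of the signature and sections of the derived homomorphism -/

/-- An extension `η` of `ι` and the identity on constants have a common extension to `C(K, 𝕋)`: they
agree on constant quasi-eigenvalues, and so define a homomorphism on `H · 𝕋`. -/
theorem exists_circleHom_extending {ψ : C(K, K)} (hfix : FixedSpaceTrivial ψ)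
    {η : quasiEigenvalues ψ →* Circle} (hη : (sig ψ hfix).Extends η) :
    ∃ p : C(K, Circle) →* Circle, (∀ h : quasiEigenvalues ψ, p h = η h) ∧
      ∀ c : Circle, p (ContinuousMap.const K c) = c := by
  let const : Circle →* C(K, Circle) :=
    { toFun := ContinuousMap.const K
      map_one' := rfl
      map_mul' := fun _ _ => rfl }
  obtain ⟨p, hp⟩ := exists_circleHom_comp_eq
    ((quasiEigenvalues ψ).subtype.coprod const) (η.coprod (MonoidHom.id Circle)) (by
      rintro ⟨h, c⟩ hhc
      have hval : ∀ x, (h : C(K, Circle)) x * c = 1 := fun x => DFunLike.congr_fun hhc x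
      have hker : h ∈ (derivedHomRestrict ψ).ker := Subtype.ext (by
        change derivedHom ψ h = 1
        rw [derivedHom_eq_one_iff]
        intro x
        exact mul_right_cancel ((hval _).trans (hval x).symm))
      change η h * c = 1
      have h1 : η h = constValue ψ hfix ⟨h, hker⟩ := hη ⟨h, hker⟩
      rw [h1]
      exact hval _)
  refine ⟨p, fun h => ?_, fun c => ?_⟩
  · simpa using DFunLike.congr_fun hp (h, 1)
  · have := DFunLike.congr_fun hp (1, c)
    simp only [MonoidHom.comp_apply, MonoidHom.coprod_apply, map_one, one_mul] at this
    exact this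

/-- A homomorphic section `s` of `Λ : G → H` adapted to `η`: the constant by which `h` and `s (Λ h)`
differ is `η h`. -/
theorem exists_quasiEigenvector_section {ψ : C(K, K)} (hfix : FixedSpaceTrivial ψ)
    {η : quasiEigenvalues ψ →* Circle} (hη : (sig ψ hfix).Extends η) :
    ∃ s : quasiEigenvalues ψ →* C(K, Circle),
      (∀ h, s h ∈ quasiEigenvectors ψ) ∧ (∀ h, derivedHom ψ (s h) = h) ∧
      (∀ (h : quasiEigenvalues ψ) x, (h : C(K, Circle)) x = s (derivedHomRestrict ψ h) x * η h) ∧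
      ∀ g ∈ quasiEigenvectors ψ, ∃ h c, g = s h * ContinuousMap.const K c := by
  obtain ⟨p, hpη, hpc⟩ := exists_circleHom_extending hfix hη
  -- Since `p` is the identity on constants, `σ g = g / p g` kills constants, that is, `ker Λ`.
  let σ : C(K, Circle) →* C(K, Circle) :=
    { toFun := fun g => g * ContinuousMap.const K (p g)⁻¹
      map_one' := by ext; simp
      map_mul' := fun a b => by
        refine ContinuousMap.ext fun x => ?_
        simp only [map_mul, ContinuousMap.mul_apply, ContinuousMap.const_apply, mul_inv]
        exact mul_mul_mul_comm _ _ _ _ }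
  have hσ : ∀ g, σ g = g * ContinuousMap.const K (p g)⁻¹ := fun _ => rfl
  let Λ := (derivedHom ψ).subgroupMap (quasiEigenvectors ψ)
  have hΛ : Function.Surjective Λ := (derivedHom ψ).subgroupMap_surjective _
  let s : quasiEigenvalues ψ →* C(K, Circle) := Λ.liftOfSurjective hΛ
    ⟨σ.comp (quasiEigenvectors ψ).subtype, fun g hg => by
      have hg1 : derivedHom ψ (g : C(K, Circle)) = 1 := congrArg Subtype.val hg
      have hg2 : (g : C(K, Circle)) = ContinuousMap.const K ((g : C(K, Circle)) hfix.1.some) :=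
        ContinuousMap.ext fun x => eq_of_derivedHom_eq_one hfix hg1 x _
      change σ (g : C(K, Circle)) = 1
      rw [hg2, hσ, hpc]
      ext
      simp⟩
  have hs : ∀ g : quasiEigenvectors ψ, s (Λ g) = σ g := fun g =>
    Λ.liftOfRightInverse_comp_apply _ _ _ g
  have hconst : ∀ c, ContinuousMap.const K c ∈ quasiEigenvectors ψ := fun c =>
    ⟨1, derivedHom_const ψ c⟩
  refine ⟨s, fun h => ?_, fun h => ?_, fun h x => ?_, fun g hg => ?_⟩
  · obtain ⟨g, rfl⟩ := hΛ h
    rw [hs]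
    exact mul_mem g.2 (hconst _)
  · obtain ⟨g, rfl⟩ := hΛ h
    rw [hs, hσ, map_mul, derivedHom_const, mul_one]
    rfl
  · have h1 : derivedHomRestrict ψ h = Λ ⟨h, quasiEigenvalues_le ψ h.2⟩ := rfl
    rw [h1, hs, hσ, hpη]
    simp
  · refine ⟨Λ ⟨g, hg⟩, p g, ?_⟩
    rw [hs, hσ]
    ext
    simp

theorem exists_extends {ψ : C(K, K)} (hfix : FixedSpaceTrivial ψ) :
    ∃ η : (sig ψ hfix).carrier →* Circle, (sig ψ hfix).Extends η := by
  obtain ⟨η, hη⟩ := exists_circleHom_comp_eq (sig ψ hfix).Λ.ker.subtype (sig ψ hfix).ι (by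
    rw [Subgroup.ker_subtype]
    exact bot_le)
  exact ⟨η, fun h => DFunLike.congr_fun hη h⟩

end Systems

/-! ### The conjugacy -/

/-- The dual of a discrete group carries the topology of pointwise convergence. -/
theorem continuous_pontryaginDual {X H : Type*} [TopologicalSpace X] [CommGroup H]
    [TopologicalSpace H] [DiscreteTopology H] {θ : X → PontryaginDual H}
    (hθ : ∀ h, Continuous fun x => θ x h) : Continuous θ := by
  refine (ContinuousMonoidHom.isInducing_toContinuousMap H Circle).continuous_iff.mpr ?_
  exact ContinuousMap.continuous_of_continuous_uncurry _
    (continuous_prod_of_discrete_right.mpr hθ)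

end QDS

end

theorem theorem3p4 {K : Type*} [TopologicalSpace K] [CompactSpace K] [T2Space K]
    (ψ : C(K, K)) (hmin : QDS.IsTotallyMinimal ψ) (hqds : QDS.HasQuasiDiscreteSpectrum ψ) :
    (∃ η : (QDS.sig ψ hmin.fixedSpaceTrivial).carrier →* Circle,
      (QDS.sig ψ hmin.fixedSpaceTrivial).Extends η) ∧
    ∀ η : (QDS.sig ψ hmin.fixedSpaceTrivial).carrier →* Circle,
      (QDS.sig ψ hmin.fixedSpaceTrivial).Extends η →
        QDS.Conjugate ψ (QDS.affineAut (QDS.sig ψ hmin.fixedSpaceTrivial).PhiDual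
          ((QDS.sig ψ hmin.fixedSpaceTrivial).toDual η)) := by
  refine ⟨QDS.exists_extends _, fun η hη => ?_⟩
  let S := QDS.sig ψ hmin.fixedSpaceTrivial
  obtain ⟨s, hsG, hsΛ, hsη, hsspan⟩ :=
    QDS.exists_quasiEigenvector_section hmin.fixedSpaceTrivial hη
  let evalHom : K → (QDS.quasiEigenvalues ψ →* Circle) := fun x =>
    { toFun := fun h => s h x
      map_one' := by rw [map_one]; rfl
      map_mul' := fun a b => by rw [map_mul]; rfl }
  let θ : K → S.Dual := fun x => S.toDual (evalHom x)
  have hcont : Continuous θ :=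
    QDS.continuous_pontryaginDual fun (h : QDS.quasiEigenvalues ψ) => (s h).continuous
  have hinj : Function.Injective θ := by
    intro x y hxy
    refine hqds.eq_of_forall fun g hg => ?_
    obtain ⟨h, c, rfl⟩ := hsspan g hg
    have hh : s h x = s h y := DFunLike.congr_fun hxy (h : S.carrier)
    simp [hh]
  have hsurj : Function.Surjective θ := by
    obtain ⟨⟨x₀⟩, -⟩ := hmin 1 le_rfl
    have hdense : DenseRange θ := QDS.denseRange_of_tendsto_birkhoffAverage ψ x₀ θ fun h hh =>
      hmin.tendsto_birkhoffAverage_zero (hsG h)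
        (fun h1 => hh (Subtype.ext ((hsΛ h).symm.trans h1))) x₀
    exact Set.range_eq_univ.mp <|
      (isCompact_range hcont).isClosed.closure_eq.symm.trans hdense.closure_range
  refine ⟨hcont.homeoOfEquivCompactToT2 (f := Equiv.ofBijective θ ⟨hinj, hsurj⟩), fun x => ?_⟩
  refine PontryaginDual.ext fun (h : QDS.quasiEigenvalues ψ) => ?_
  change s h (ψ x) = s (h * QDS.derivedHomRestrict ψ h) x * η h
  have h1 : s h (ψ x) = s h x * (h : C(K, Circle)) x := by
    rw [← hsΛ h, QDS.derivedHom_apply, mul_comm (s h (ψ x)), mul_inv_cancel_left]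
  rw [h1, map_mul, hsη h x, ContinuousMap.mul_apply, mul_assoc]
  rfl
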